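/- Let $\mathcal G$ be a finite directed graph on $N$ nodes (self-loops allowed), with adjacency matrix $A=(a_{i,j})\in\{0,1\}^{N\times N}$, where $a_{i,j}=1$ iff there is an edge from $j$ to $i$, and let $d^{\mathrm{in}}_i=\sum_j a_{i,j}$, $d^{\mathrm{out}}_j=\sum_i a_{i,j}$. Assume that $\mathcal G$ is strongly connected and aperiodic (the greatest common divisor of the lengths of its directed cycles is $1$; in particular there is a directed cycle). Let $L=D_{\mathrm{in}}^{-1/2}AD_{\mathrm{out}}^{-1/2}$ with $D_{\mathrm{in}}=\mathrm{diag}(d^{\mathrm{in}}_i)$, $D_{\mathrm{out}}=\mathrm{diag}(d^{\mathrm{out}}_j)$ be the symmetrically normalized adjacency (SNA), and for $x\in\mathbb R^{N\times K}$ with rows $x_i$ define the Dirichlet energy $$\mathfrak E(x)=\frac14\sum_{i,j=1}^N a_{i,j}\left\|\frac{x_i}{\sqrt{d^{\mathrm{in}}_i}}-\frac{x_j}{\sqrt{d^{\mathrm{out}}_j}}\right\|_2^2 .$$ Let $W\in\mathbb R^{K\times K}$ be any matrix that is not nilpotent (for instance, any nonzero symmetric matrix), and consider the GCN update rule $x_{t+1}=Lx_tW$,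 $t=0,1,2,\dots$, with input node features $x_0\in\mathbb R^{N\times K}$. Then the GCN oversmooths. That is, among the complex eigenvalues of $I-L$ the smallest real part is attained at a real eigenvalue $\lambda_1\ge 0$, and for (Lebesgue-)almost every $x_0\in\mathbb R^{N\times K}$ the following holds: $x_t\neq 0$ for all $t\ge 0$; the normalized Dirichlet energy converges to the lowest-frequency value (the dynamics is lowest-frequency-dominant), $$\mathfrak E\!\left(\frac{x_t}{\|x_t\|_F}\right)\xrightarrow[t\to\infty]{}\frac{\lambda_1}{2};$$ and it does so exponentially fast, i.e. there is a constant $C>0$ (depending on $\mathcal G$, $W$ and $x_0$) such that for all integers $t\ge 1$ $$\left|\mathfrak E\!\left(\frac{x_t}{\|x_t\|_F}\right)-\frac{\lambda_1}{2}\right|\le e^{-Ct}.$$ -/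

import Mathlib

open MeasureTheory Filter Topology

noncomputable section

namespace Digraph

variable {V : Type*} (G : Digraph V)

/-- There is a directed walk with exactly `n` edges from `u` to `v`. -/
def HasWalk : ℕ → V → V → Prop
  | 0, u, v => u = v
  | n + 1, u, v => ∃ w, G.Adj u w ∧ HasWalk n w v

/-- Any node can be reached from any other node along a directed walk. -/
def IsStronglyConnected : Prop := ∀ u v : V, ∃ n : ℕ, G.HasWalk n u v

/-- The greatest common divisor of the lengths of all directed cycles (equivalently, of all
closed directed walks) exists and is `1`. A graph without directed cycles is not aperiodic. -/
def IsAperiodic : Prop :=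
  ∀ d : ℕ, (∀ (n : ℕ) (v : V), G.HasWalk n v v → d ∣ n) → d = 1

open Classical in
/-- The adjacency matrix: the entry `(i, j)` is `1` if there is an edge from `j` to `i`. -/
def adjacency : Matrix V V ℝ := Matrix.of fun i j => if G.Adj j i then 1 else 0

variable [Fintype V]

/-- In-degree: row sums of the adjacency matrix. -/
def inDeg (i : V) : ℝ := ∑ j, G.adjacency i j

/-- Out-degree: column sums of the adjacency matrix. -/
def outDeg (j : V) : ℝ := ∑ i, G.adjacency i j

/-- The Dirichlet energy of real node features. -/
def dirichletEnergy {κ : Type*} [Fintype κ] (x : Matrix V κ ℝ) : ℝ :=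
  (1 / 4) * ∑ i, ∑ j, G.adjacency i j *
    ∑ k, (x i k / √(G.inDeg i) - x j k / √(G.outDeg j)) ^ 2

variable [DecidableEq V]

/-- The symmetrically normalized adjacency `D_in^(-1/2) A D_out^(-1/2)`. -/
def sna : Matrix V V ℝ :=
  Matrix.diagonal (fun i => (√(G.inDeg i))⁻¹) * G.adjacency *
    Matrix.diagonal (fun j => (√(G.outDeg j))⁻¹)

/-- The set of complex eigenvalues (frequencies) of the symmetrically normalized Laplacian
`I - L`, where `L` is the symmetrically normalized adjacency. -/
def frequencies : Set ℂ := spectrum ℂ ((1 - G.sna).map (fun r : ℝ => (r : ℂ)))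

/-- The real number `l` is an eigenvalue of `I - L`, and it is smallest among all the complex
eigenvalues with respect to the real part. -/
def IsLowestFrequency (l : ℝ) : Prop :=
  (l : ℂ) ∈ G.frequencies ∧ ∀ z ∈ G.frequencies, l ≤ z.re

/-- The node features after `t` layers, `x_{t+1} = L x_t W`. -/
def gcn {κ : Type*} [Fintype κ] (W : Matrix κ κ ℝ) (x₀ : Matrix V κ ℝ) : ℕ → Matrix V κ ℝ
  | 0 => x₀
  | t + 1 => G.sna * gcn W x₀ t * W

end Digraph

/-- The node features divided by their Frobenius norm. -/
def normalizeFeatures {V κ : Type*} [Fintype V] [Fintype κ] (x : Matrix V κ ℝ) : Matrix V κ ℝ :=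
  (√(∑ i, ∑ k, x i k ^ 2))⁻¹ • x

namespace Digraph

variable {V κ : Type*} (G : Digraph V) [Fintype V] [Fintype κ]

/-- The sequence of node features is `l`-frequency-dominant: its normalized Dirichlet energy tends
to `l / 2`. -/
def IsFrequencyDominant (x : ℕ → Matrix V κ ℝ) (l : ℝ) : Prop :=
  Tendsto (fun t => G.dirichletEnergy (normalizeFeatures (x t))) atTop (𝓝 (l / 2))

/-- The normalized Dirichlet energy approaches `l / 2` exponentially fast. -/
def DecaysExponentially (x : ℕ → Matrix V κ ℝ) (l : ℝ) : Prop :=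
  ∃ C : ℝ, 0 < C ∧ ∀ t : ℕ, 0 < t →
    |G.dirichletEnergy (normalizeFeatures (x t)) - l / 2| ≤ Real.exp (-C * t)

end Digraph

end

/-!
Write `L` for the symmetrically normalized adjacency. Strong connectivity and aperiodicity make `L`
primitive, so it has a positive left eigenvector `u`, with eigenvalue `ρ`, and `λ₁ = 1 - ρ` is the
lowest frequency. A power of `L` contracts the `u`-weighted `ℓ¹` norm on the orthogonal complement
of `u`, which contains the range of `L - ρ`; hence `L ^ t (L - ρ) = O(q ^ t)` for some `q < ρ`.

Since `𝔈(x) = (‖x‖² - ⟪x, L x⟫) / 2`, the normalized energy of `x_t = L ^ t x₀ W ^ t` differs from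
`λ₁ / 2` by at most `‖(L - ρ) x_t‖ / ‖x_t‖`. If `μ` is an eigenvalue of `W` of largest modulus, with
eigenvector `w`, the numerator is `O((q c) ^ t)` for every `c > |μ|`. The functional `x ↦ uᵀ x w` is
multiplied by `ρ μ` in each layer, so the denominator is at least a multiple of `(ρ |μ|) ^ t` unless
`x₀` lies in the kernel of this functional, a null set. Finally, the error is strictly less than `1`
at every single `t`, which is what lets the bound `exp (-C t)` hold already from `t = 1`.
-/

namespace Oversmoothing

open Asymptotics
open scoped Matrix Matrix.Norms.Frobenius

section Walks

variable {V : Type*} {G : Digraph V}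

theorem hasWalk_trans {m n : ℕ} {u v w : V} (huv : G.HasWalk m u v) (hvw : G.HasWalk n v w) :
    G.HasWalk (m + n) u w := by
  induction m generalizing u with
  | zero => cases huv; simpa using hvw
  | succ m ih =>
    obtain ⟨a, hua, hav⟩ := huv
    rw [Nat.add_right_comm]
    exact ⟨a, hua, ih hav⟩

theorem exists_adj_of_hasWalk_succ {n : ℕ} {u v : V} (h : G.HasWalk (n + 1) u v) :
    ∃ w, G.Adj w v := by
  induction n generalizing u with
  | zero => obtain ⟨w, huw, rfl⟩ := h; exact ⟨u, huw⟩
  | succ n ih => obtain ⟨w, -, hwv⟩ := h; exact ih hwv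

/-- The lengths of the closed walks through a node, a submonoid of `ℕ` because closed walks can be
concatenated. -/
def closedWalkLengths (G : Digraph V) (v : V) : AddSubmonoid ℕ where
  carrier := {n | G.HasWalk n v v}
  zero_mem' := rfl
  add_mem' := hasWalk_trans

theorem setGcd_closedWalkLengths (hconn : G.IsStronglyConnected) (haper : G.IsAperiodic) (v : V) :
    Nat.setGcd (closedWalkLengths G v : Set ℕ) = 1 := by
  refine haper _ fun n w hw => ?_
  obtain ⟨a, hvw⟩ := hconn v w
  obtain ⟨b, hwv⟩ := hconn w v
  have hdirect := Nat.setGcd_dvd_of_mem (s := closedWalkLengths G v) (hasWalk_trans hvw hwv)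
  have hdetour := Nat.setGcd_dvd_of_mem (s := closedWalkLengths G v)
    (hasWalk_trans hvw (hasWalk_trans hw hwv))
  rw [add_left_comm] at hdetour
  exact (Nat.dvd_add_iff_left hdirect).2 hdetour

theorem exists_forall_ge_hasWalk_self (hconn : G.IsStronglyConnected) (haper : G.IsAperiodic)
    (v : V) : ∃ N, ∀ n ≥ N, G.HasWalk n v v := by
  obtain ⟨N, hN⟩ := Nat.exists_mem_closure_of_ge (closedWalkLengths G v : Set ℕ)
  rw [setGcd_closedWalkLengths hconn haper, AddSubmonoid.closure_eq] at hN
  exact ⟨N, fun n hn => hN n hn (one_dvd n)⟩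

theorem nonempty_of_isAperiodic (haper : G.IsAperiodic) : Nonempty V := by
  by_contra hempty
  exact absurd (haper 2 fun _ v => (hempty ⟨v⟩).elim) (by decide)

theorem exists_forall_hasWalk [Finite V] (hconn : G.IsStronglyConnected)
    (haper : G.IsAperiodic) : ∃ m > 0, ∀ u v, G.HasWalk m u v := by
  obtain ⟨v₀⟩ := nonempty_of_isAperiodic haper
  obtain ⟨N, hN⟩ := exists_forall_ge_hasWalk_self hconn haper v₀
  choose a ha using fun u => hconn u v₀
  choose b hb using hconn v₀
  obtain ⟨A, hA⟩ := Set.finite_range a |>.bddAbove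
  obtain ⟨B, hB⟩ := Set.finite_range b |>.bddAbove
  refine ⟨A + (N + 1) + B, by omega, fun u v => ?_⟩
  have hau : a u ≤ A := hA ⟨u, rfl⟩
  have hbv : b v ≤ B := hB ⟨v, rfl⟩
  have hlen : A + (N + 1) + B = a u + (A - a u + (N + 1) + (B - b v)) + b v := by omega
  rw [hlen]
  exact hasWalk_trans (hasWalk_trans (ha u) (hN _ (by omega))) (hb v)

end Walks

section NormalizedAdjacency

variable {V : Type*} {G : Digraph V}

theorem adjacency_nonneg (i j : V) : 0 ≤ G.adjacency i j := by
  simp only [Digraph.adjacency, Matrix.of_apply]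
  split_ifs <;> norm_num

theorem adjacency_pos {i j : V} (h : G.Adj j i) : 0 < G.adjacency i j := by
  simp [Digraph.adjacency, h]

variable [Fintype V]

theorem inDeg_pos_of_adj {i j : V} (h : G.Adj j i) : 0 < G.inDeg i :=
  Finset.sum_pos' (fun _ _ => adjacency_nonneg _ _) ⟨j, Finset.mem_univ j, adjacency_pos h⟩

theorem outDeg_pos_of_adj {i j : V} (h : G.Adj j i) : 0 < G.outDeg j :=
  Finset.sum_pos' (fun _ _ => adjacency_nonneg _ _) ⟨i, Finset.mem_univ i, adjacency_pos h⟩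

theorem inDeg_pos (hconn : G.IsStronglyConnected) (haper : G.IsAperiodic) (i : V) :
    0 < G.inDeg i := by
  obtain ⟨m, hm, hwalk⟩ := exists_forall_hasWalk hconn haper
  obtain ⟨m, rfl⟩ := Nat.exists_eq_succ_of_ne_zero hm.ne'
  obtain ⟨j, hj⟩ := exists_adj_of_hasWalk_succ (hwalk i i)
  exact inDeg_pos_of_adj hj

theorem outDeg_pos (hconn : G.IsStronglyConnected) (haper : G.IsAperiodic) (j : V) :
    0 < G.outDeg j := by
  obtain ⟨m, hm, hwalk⟩ := exists_forall_hasWalk hconn haper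
  obtain ⟨m, rfl⟩ := Nat.exists_eq_succ_of_ne_zero hm.ne'
  obtain ⟨i, hi, -⟩ := hwalk j j
  exact outDeg_pos_of_adj hi

variable [DecidableEq V]

theorem sna_apply (i j : V) :
    G.sna i j = (√(G.inDeg i))⁻¹ * G.adjacency i j * (√(G.outDeg j))⁻¹ := by
  simp only [Digraph.sna, Matrix.mul_diagonal, Matrix.diagonal_mul]

theorem sna_nonneg (i j : V) : 0 ≤ G.sna i j := by
  have := adjacency_nonneg (G := G) i j
  rw [sna_apply]
  positivity

theorem sna_pos {i j : V} (h : G.Adj j i) : 0 < G.sna i j := by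
  have := adjacency_pos h
  have := inDeg_pos_of_adj h
  have := outDeg_pos_of_adj h
  rw [sna_apply]
  positivity

theorem pow_apply_pos_of_hasWalk {A : Matrix V V ℝ} (hA : ∀ i j, 0 ≤ A i j)
    (hpos : ∀ i j, G.Adj j i → 0 < A i j) {n : ℕ} {u v : V} (h : G.HasWalk n u v) :
    0 < (A ^ n) v u := by
  induction n generalizing u with
  | zero => cases h; simp
  | succ n ih =>
    obtain ⟨w, huw, hwv⟩ := h
    rw [pow_succ, Matrix.mul_apply]
    exact Finset.sum_pos' (fun k _ => mul_nonneg (Matrix.pow_apply_nonneg hA n v k) (hA k u))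
      ⟨w, Finset.mem_univ w, mul_pos (ih hwv) (hpos w u huw)⟩

theorem isPrimitive_sna (hconn : G.IsStronglyConnected) (haper : G.IsAperiodic) :
    G.sna.IsPrimitive := by
  obtain ⟨m, hm, hwalk⟩ := exists_forall_hasWalk hconn haper
  exact ⟨sna_nonneg, m, hm, fun i j =>
    pow_apply_pos_of_hasWalk sna_nonneg (fun _ _ => sna_pos) (hwalk j i)⟩

end NormalizedAdjacency

section Growth

theorem isBigO_pow_of_add_le {f : ℕ → ℝ} (hf : ∀ t, 0 ≤ f t) {q : ℝ} (hq : 0 < q) {m : ℕ}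
    (hm : 0 < m) (hstep : ∀ t, f (t + m) ≤ q ^ m * f t) : f =O[atTop] fun t => q ^ t := by
  have hmod : ∀ t, f t / q ^ t ≤ f (t % m) / q ^ (t % m) := by
    intro t
    induction t using Nat.strong_induction_on with
    | _ t ih =>
      rcases lt_or_ge t m with hlt | hge
      · rw [Nat.mod_eq_of_lt hlt]
      · obtain ⟨s, rfl⟩ := Nat.exists_eq_add_of_le' hge
        rw [Nat.add_mod_right]
        refine le_trans ?_ (ih s (by omega))
        rw [div_le_div_iff₀ (by positivity) (by positivity), pow_add]
        nlinarith [mul_le_mul_of_nonneg_right (hstep s) (pow_pos hq s).le]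
  obtain ⟨C, hC⟩ := ((Set.finite_Iio m).image fun s => f s / q ^ s).bddAbove
  refine IsBigO.of_bound C (Eventually.of_forall fun t => ?_)
  rw [Real.norm_of_nonneg (hf t), Real.norm_of_nonneg (by positivity),
    ← div_le_iff₀ (by positivity)]
  exact (hmod t).trans (hC ⟨t % m, Nat.mod_lt t hm, rfl⟩)

theorem isBigO_of_forall_apply {m n α : Type*} [Fintype m] [Fintype n] {l : Filter α}
    {F : α → Matrix m n ℝ} {g : α → ℝ} (h : ∀ i j, (fun a => F a i j) =O[l] g) : F =O[l] g := by
  classical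
  have hF : F = fun a => ∑ i, ∑ j, F a i j • (Matrix.single i j 1 : Matrix m n ℝ) := by
    ext1 a
    conv_lhs => rw [Matrix.matrix_eq_sum_single (F a)]
    simp only [Matrix.smul_single, smul_eq_mul, mul_one]
  rw [hF]
  refine IsBigO.fun_sum fun i _ => IsBigO.fun_sum fun j _ => ?_
  have hsingle : (fun a => F a i j • (Matrix.single i j 1 : Matrix m n ℝ)) =O[l] (F · i j) :=
    IsBigO.of_bound ‖(Matrix.single i j 1 : Matrix m n ℝ)‖ (Eventually.of_forall fun a => by
      rw [norm_smul, mul_comm])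
  exact hsingle.trans (h i j)

end Growth

section Perron

variable {n : Type*} [Fintype n] {A : Matrix n n ℝ} {ρ : ℝ} {u : n → ℝ}

theorem exists_pos_forall_mul_le {ι : Type*} [Finite ι] {a : ι → ℝ} (ha : ∀ i, 0 < a i)
    (b : ι → ℝ) : ∃ ε > 0, ∀ i, ε * b i ≤ a i := by
  have hsmall : ∀ᶠ ε : ℝ in 𝓝[>] 0, ∀ i, ε * b i ≤ a i := by
    refine eventually_all.2 fun i => eventually_nhdsWithin_of_eventually_nhds ?_
    have hlim : Tendsto (fun ε : ℝ => ε * b i) (𝓝 0) (𝓝 0) := by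
      simpa using (tendsto_id (x := 𝓝 (0 : ℝ))).mul_const (b i)
    exact hlim.eventually (ge_mem_nhds (ha i))
  obtain ⟨ε, hε, hpos⟩ := (hsmall.and self_mem_nhdsWithin).exists
  exact ⟨ε, hpos, hε⟩

theorem dotProduct_pos {x y : n → ℝ} (hx : ∀ i, 0 < x i) (hy : 0 ≤ y) (hy0 : y ≠ 0) :
    0 < x ⬝ᵥ y := by
  obtain ⟨j, hj⟩ := Function.ne_iff.1 hy0
  exact Finset.sum_pos' (fun k _ => mul_nonneg (hx k).le (hy k))
    ⟨j, Finset.mem_univ j, mul_pos (hx j) ((hy j).lt_of_ne' hj)⟩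

theorem le_sum_of_smul_le_mulVec (hA : ∀ i j, 0 ≤ A i j) {r : ℝ} {y : n → ℝ}
    (hy : y ∈ stdSimplex ℝ n) (hle : r • y ≤ A *ᵥ y) : r ≤ ∑ i, ∑ j, A i j :=
  calc r = ∑ i, (r • y) i := by simp [← Finset.mul_sum, hy.2]
    _ ≤ ∑ i, (A *ᵥ y) i := Finset.sum_le_sum fun i _ => hle i
    _ ≤ ∑ i, ∑ j, A i j := Finset.sum_le_sum fun i _ => Finset.sum_le_sum fun j _ =>
        mul_le_of_le_one_right (hA i j)
          ((Finset.single_le_sum (fun k _ => hy.1 k) (Finset.mem_univ j)).trans_eq hy.2)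

theorem exists_collatzWielandt_maximizer [Nonempty n] (hA : ∀ i j, 0 ≤ A i j) :
    ∃ (ρ : ℝ) (y : n → ℝ), 0 ≤ y ∧ y ≠ 0 ∧ ρ • y ≤ A *ᵥ y ∧
      ∀ (r : ℝ) (z : n → ℝ), 0 ≤ z → z ≠ 0 → r • z ≤ A *ᵥ z → r ≤ ρ := by
  classical
  let K : Set (ℝ × (n → ℝ)) :=
    (Set.Icc 0 (∑ i, ∑ j, A i j) ×ˢ stdSimplex ℝ n) ∩ {p | p.1 • p.2 ≤ A *ᵥ p.2}
  have hK : IsCompact K :=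
    (isCompact_Icc.prod (isCompact_stdSimplex ℝ n)).inter_right
      (isClosed_le (by fun_prop) (by fun_prop))
  have hnormalize : ∀ (r : ℝ) (z : n → ℝ), 0 ≤ r → 0 ≤ z → z ≠ 0 → r • z ≤ A *ᵥ z →
      (r, (∑ i, z i)⁻¹ • z) ∈ K := by
    intro r z hr hz hz0 hle
    have hs : 0 < ∑ i, z i := by
      simpa only [one_dotProduct] using dotProduct_pos (x := 1) (fun _ => one_pos) hz hz0
    have hmem : (∑ i, z i)⁻¹ • z ∈ stdSimplex ℝ n :=
      ⟨fun i => mul_nonneg (inv_nonneg.2 hs.le) (hz i), by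
        simp [← Finset.mul_sum, inv_mul_cancel₀ hs.ne']⟩
    have hle' : r • (∑ i, z i)⁻¹ • z ≤ A *ᵥ ((∑ i, z i)⁻¹ • z) := by
      rw [smul_comm, Matrix.mulVec_smul]
      exact smul_le_smul_of_nonneg_left hle (inv_nonneg.2 hs.le)
    exact ⟨⟨⟨hr, le_sum_of_smul_le_mulVec hA hmem hle'⟩, hmem⟩, hle'⟩
  have hKne : K.Nonempty := ⟨_, hnormalize 0 1 le_rfl zero_le_one one_ne_zero <| by
    rw [zero_smul]
    exact fun i => dotProduct_nonneg_of_nonneg (hA i) zero_le_one⟩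
  obtain ⟨⟨ρ, y⟩, ⟨⟨⟨hρ, -⟩, hy⟩, hle⟩, hmax⟩ := hK.exists_isMaxOn hKne continuous_fst.continuousOn
  refine ⟨ρ, y, hy.1, ?_, hle, fun r z hz hz0 hrz => ?_⟩
  · rintro rfl
    simpa using hy.2
  · rcases le_total r 0 with hr | hr
    · exact hr.trans hρ
    · exact hmax (hnormalize r z hr hz hz0 hrz)

theorem mulVec_pos {P : Matrix n n ℝ} (hP : ∀ i j, 0 < P i j) {y : n → ℝ} (hy : 0 ≤ y)
    (hy0 : y ≠ 0) (i : n) : 0 < (P *ᵥ y) i :=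
  dotProduct_pos (hP i) hy hy0

theorem sum_mul_norm_sum_smul_le {E : Type*} [SeminormedAddCommGroup E] [NormedSpace ℝ E]
    (hA : ∀ i j, 0 ≤ A i j) (hu : 0 ≤ u) (huA : u ᵥ* A = ρ • u) (w : n → E) :
    ∑ i, u i * ‖∑ j, A i j • w j‖ ≤ ρ * ∑ i, u i * ‖w i‖ :=
  calc ∑ i, u i * ‖∑ j, A i j • w j‖ ≤ u ⬝ᵥ A *ᵥ (‖w ·‖) := by
        refine Finset.sum_le_sum fun i _ => mul_le_mul_of_nonneg_left ?_ (hu i)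
        refine norm_sum_le_of_le _ fun j _ => ?_
        rw [norm_smul, Real.norm_of_nonneg (hA i j)]
    _ = ρ * ∑ i, u i * ‖w i‖ := by
        rw [Matrix.dotProduct_mulVec, huA, smul_dotProduct, smul_eq_mul, dotProduct]

theorem norm_le_of_map_mulVec_eq_smul (hA : ∀ i j, 0 ≤ A i j) (hu : ∀ i, 0 < u i)
    (huA : u ᵥ* A = ρ • u) {w : n → ℂ} (hw : w ≠ 0) {μ : ℂ}
    (h : A.map Complex.ofReal *ᵥ w = μ • w) : ‖μ‖ ≤ ρ := by
  have hpos : 0 < u ⬝ᵥ (‖w ·‖) := dotProduct_pos hu (fun i => norm_nonneg (w i)) fun h0 =>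
    hw (funext fun i => norm_eq_zero.1 (congrFun h0 i))
  have hAw : ∀ i, ∑ j, A i j • w j = μ * w i := fun i => by
    simpa [Matrix.mulVec, dotProduct] using congrFun h i
  have hle := sum_mul_norm_sum_smul_le hA (fun i => (hu i).le) huA w
  simp only [hAw, norm_mul, mul_left_comm _ ‖μ‖, ← Finset.mul_sum] at hle
  exact le_of_mul_le_mul_right hle hpos

/- Doeblin's argument: `P` dominates the rank-one matrix with rows `δ u`, which vanishes on the
orthogonal complement of `u`, so there `P` acts as the smaller nonnegative matrix `Q`. -/
theorem exists_lt_dotProduct_abs_mulVec_le [Nonempty n] {P : Matrix n n ℝ} {r : ℝ}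
    (hP : ∀ i j, 0 < P i j) (hu : ∀ i, 0 < u i) (huP : u ᵥ* P = r • u) :
    ∃ θ < r, ∀ w, u ⬝ᵥ w = 0 → u ⬝ᵥ |P *ᵥ w| ≤ θ * (u ⬝ᵥ |w|) := by
  obtain ⟨δ, hδ, hle⟩ := exists_pos_forall_mul_le (ι := n × n) (fun p => hP p.1 p.2) (u ·.2)
  let Q : Matrix n n ℝ := P - δ • Matrix.vecMulVec 1 u
  have hQ : ∀ i j, 0 ≤ Q i j := fun i j => by
    simpa [Q, Matrix.vecMulVec_apply] using hle (i, j)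
  have huQ : u ᵥ* Q = (r - δ * (u ⬝ᵥ 1)) • u := by
    simp only [Q, Matrix.vecMul_sub, Matrix.vecMul_smul, Matrix.vecMul_vecMulVec, huP, sub_smul,
      smul_smul]
  have hu1 : 0 < u ⬝ᵥ 1 := dotProduct_pos hu zero_le_one one_ne_zero
  refine ⟨r - δ * (u ⬝ᵥ 1), sub_lt_self r (mul_pos hδ hu1), fun w huw => ?_⟩
  have hPw : P *ᵥ w = Q *ᵥ w := by
    simp only [Q, Matrix.sub_mulVec, Matrix.smul_mulVec, Matrix.vecMulVec_mulVec, huw,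
      MulOpposite.op_zero, zero_smul, smul_zero, sub_zero]
  rw [hPw]
  exact sum_mul_norm_sum_smul_le hQ (fun i => (hu i).le) huQ w

variable [DecidableEq n]

theorem pow_mulVec_eq_smul {v : n → ℝ} (h : A *ᵥ v = ρ • v) (t : ℕ) :
    (A ^ t) *ᵥ v = ρ ^ t • v := by
  induction t with
  | zero => simp
  | succ t ih => rw [pow_succ, ← Matrix.mulVec_mulVec, h, Matrix.mulVec_smul, ih, smul_smul,
      pow_succ']

theorem vecMul_pow_eq_smul (h : u ᵥ* A = ρ • u) (t : ℕ) : u ᵥ* A ^ t = ρ ^ t • u := by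
  rw [← Matrix.mulVec_transpose] at h ⊢
  rw [Matrix.transpose_pow, pow_mulVec_eq_smul h]

/- If `A y ≠ ρ y` at a Collatz–Wielandt maximizer, then `z = A ^ m y` satisfies `A z > ρ z`
strictly in every coordinate, which leaves room for a larger `ρ`. -/
theorem exists_pos_eigenvector [Nonempty n] (hA : A.IsPrimitive) :
    ∃ (ρ : ℝ) (v : n → ℝ), 0 < ρ ∧ (∀ i, 0 < v i) ∧ A *ᵥ v = ρ • v := by
  obtain ⟨m, hm, hpos⟩ := hA.exists_pos_pow
  obtain ⟨ρ, y, hy, hy0, hle, hmax⟩ := exists_collatzWielandt_maximizer hA.nonneg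
  have hz : ∀ i, 0 < (A ^ m *ᵥ y) i := mulVec_pos hpos hy hy0
  have heq : A *ᵥ y = ρ • y := by
    by_contra hne
    have hgap := mulVec_pos hpos (sub_nonneg.2 hle) (sub_ne_zero.2 hne)
    obtain ⟨ε, hε, hεz⟩ := exists_pos_forall_mul_le hgap (A ^ m *ᵥ y)
    have hlarger : (ρ + ε) • (A ^ m *ᵥ y) ≤ A *ᵥ (A ^ m *ᵥ y) := fun i => by
      have h := hεz i
      rw [Matrix.mulVec_sub, Matrix.mulVec_smul, Matrix.mulVec_mulVec, ← pow_succ, pow_succ',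
        ← Matrix.mulVec_mulVec, Pi.sub_apply, le_sub_iff_add_le] at h
      simpa [add_mul, add_comm] using h
    have hz0 : A ^ m *ᵥ y ≠ 0 := fun h => (hz (Classical.arbitrary n)).ne' (congrFun h _)
    linarith [hmax _ _ (fun i => (hz i).le) hz0 hlarger]
  have hρ : 0 ≤ ρ := hmax 0 y hy hy0 <| by
    rw [zero_smul]
    exact fun i => dotProduct_nonneg_of_nonneg (hA.nonneg i) hy
  have hzy : ∀ i, 0 < ρ ^ m * y i := fun i => by
    simpa [pow_mulVec_eq_smul heq m] using hz i
  refine ⟨ρ, y, hρ.lt_of_ne' ?_, fun i => pos_of_mul_pos_right (hzy i) (by positivity), heq⟩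
  rintro rfl
  simpa [hm.ne'] using hzy (Classical.arbitrary n)

theorem exists_pos_left_eigenvector [Nonempty n] (hA : A.IsPrimitive) :
    ∃ (ρ : ℝ) (u : n → ℝ), 0 < ρ ∧ (∀ i, 0 < u i) ∧ u ᵥ* A = ρ • u := by
  obtain ⟨m, hm, hpos⟩ := hA.exists_pos_pow
  have hAT : Aᵀ.IsPrimitive := ⟨fun i j => hA.nonneg j i, m, hm, fun i j => by
    rw [← Matrix.transpose_pow]
    exact hpos j i⟩
  simpa only [Matrix.mulVec_transpose] using exists_pos_eigenvector hAT

theorem eq_zero_of_mulVec_eq_neg_smul (hA : A.IsPrimitive) (hρ : 0 < ρ)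
    (hu : ∀ i, 0 < u i) (huA : u ᵥ* A = ρ • u) {w : n → ℝ} (hw : A *ᵥ w = -ρ • w) : w = 0 := by
  by_contra hw0
  have : Nonempty n := (Function.ne_iff.1 hw0).nonempty
  obtain ⟨m, -, hpos⟩ := hA.exists_pos_pow
  obtain ⟨θ, hθ, hcontr⟩ := exists_lt_dotProduct_abs_mulVec_le hpos hu (vecMul_pow_eq_smul huA m)
  have huw : u ⬝ᵥ w = 0 := by
    have h : u ᵥ* A ⬝ᵥ w = u ⬝ᵥ A *ᵥ w := (Matrix.dotProduct_mulVec u A w).symm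
    rw [huA, hw, smul_dotProduct, dotProduct_smul, smul_eq_mul, smul_eq_mul] at h
    exact (mul_eq_zero.1 (by linarith : ρ * (u ⬝ᵥ w) = 0)).resolve_left hρ.ne'
  have hle := hcontr w huw
  have habs : |A ^ m *ᵥ w| = ρ ^ m • |w| := by
    ext i
    simp [pow_mulVec_eq_smul hw, abs_mul, abs_of_pos hρ]
  rw [habs, dotProduct_smul, smul_eq_mul] at hle
  have hNw : 0 < u ⬝ᵥ |w| := dotProduct_pos hu (abs_nonneg w) fun h =>
    hw0 (funext fun i => abs_eq_zero.1 (congrFun h i))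
  exact hθ.not_ge (le_of_mul_le_mul_right hle hNw)

theorem exists_isBigO_dotProduct_abs_pow_mulVec [Nonempty n] (hA : A.IsPrimitive) (hρ : 0 < ρ)
    (hu : ∀ i, 0 < u i) (huA : u ᵥ* A = ρ • u) :
    ∃ q, 0 < q ∧ q < ρ ∧ ∀ w, u ⬝ᵥ w = 0 →
      (fun t => u ⬝ᵥ |A ^ t *ᵥ w|) =O[atTop] fun t => q ^ t := by
  obtain ⟨m, hm, hpos⟩ := hA.exists_pos_pow
  obtain ⟨θ, hθ, hcontr⟩ := exists_lt_dotProduct_abs_mulVec_le hpos hu (vecMul_pow_eq_smul huA m)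
  obtain ⟨q, ⟨hθq, hq⟩, hqρ⟩ : ∃ q, (θ < q ^ m ∧ 0 < q) ∧ q < ρ := by
    have hcont : Tendsto (fun q : ℝ => q ^ m) (𝓝[<] ρ) (𝓝 (ρ ^ m)) :=
      (continuous_pow m).continuousAt.mono_left nhdsWithin_le_nhds
    exact (((hcont.eventually_const_lt hθ).and
      (eventually_nhdsWithin_of_eventually_nhds (lt_mem_nhds hρ))).and self_mem_nhdsWithin).exists
  have hN : ∀ w, 0 ≤ u ⬝ᵥ |w| := fun w =>
    dotProduct_nonneg_of_nonneg (fun i => (hu i).le) (abs_nonneg w)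
  refine ⟨q, hq, hqρ, fun w huw => isBigO_pow_of_add_le (fun t => hN _) hq hm fun t => ?_⟩
  have huAw : u ⬝ᵥ A ^ t *ᵥ w = 0 := by
    rw [Matrix.dotProduct_mulVec, vecMul_pow_eq_smul huA, smul_dotProduct, huw, smul_zero]
  rw [add_comm t m, pow_add, ← Matrix.mulVec_mulVec]
  exact (hcontr _ huAw).trans (mul_le_mul_of_nonneg_right hθq.le (hN _))

theorem exists_isBigO_pow_mul_sub [Nonempty n] (hA : A.IsPrimitive) (hρ : 0 < ρ)
    (hu : ∀ i, 0 < u i) (huA : u ᵥ* A = ρ • u) :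
    ∃ q, 0 < q ∧ q < ρ ∧
      (fun t => A ^ t * (A - ρ • (1 : Matrix n n ℝ))) =O[atTop] fun t => q ^ t := by
  obtain ⟨q, hq, hqρ, hdecay⟩ := exists_isBigO_dotProduct_abs_pow_mulVec hA hρ hu huA
  refine ⟨q, hq, hqρ, isBigO_of_forall_apply fun i j => ?_⟩
  have huD : u ᵥ* (A - ρ • (1 : Matrix n n ℝ)) = 0 := by
    rw [Matrix.vecMul_sub, huA, Matrix.vecMul_smul, Matrix.vecMul_one, sub_self]
  refine IsBigO.trans (IsBigO.of_bound (u i)⁻¹ (Eventually.of_forall fun t => ?_))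
    (hdecay ((A - ρ • (1 : Matrix n n ℝ)).col j) (congrFun huD j))
  rw [inv_mul_eq_div, le_div_iff₀ (hu i), mul_comm]
  exact (Finset.single_le_sum
    (f := fun k => u k * |(A ^ t * (A - ρ • (1 : Matrix n n ℝ))) k j|)
    (fun k _ => mul_nonneg (hu k).le (abs_nonneg _)) (Finset.mem_univ i)).trans
      (Real.le_norm_self _)

end Perron

section SpectralGrowth

theorem isBigO_pow_of_spectralRadius_lt {𝔸 : Type*} [NormedRing 𝔸] [NormedAlgebra ℂ 𝔸]
    [CompleteSpace 𝔸] {a : 𝔸} {c : ℝ} (h : spectralRadius ℂ a < ENNReal.ofReal c) :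
    (fun t => a ^ t) =O[atTop] fun t => c ^ t := by
  have hc : 0 < c := ENNReal.ofReal_pos.1 (pos_of_gt h)
  have hroot := (spectrum.pow_norm_pow_one_div_tendsto_nhds_spectralRadius a).eventually_lt_const h
  refine IsBigO.of_norm_eventuallyLE ?_
  filter_upwards [hroot, eventually_ne_atTop 0] with t ht ht0
  rw [ENNReal.ofReal_lt_ofReal_iff hc, one_div] at ht
  calc ‖a ^ t‖ = (‖a ^ t‖ ^ (t⁻¹ : ℝ)) ^ t := (Real.rpow_inv_natCast_pow (norm_nonneg _) ht0).symm
    _ ≤ c ^ t := by gcongr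

variable {n : Type*} [Fintype n] [DecidableEq n]

theorem mem_spectrum_iff_exists_mulVec {K : Type*} [Field K] {M : Matrix n n K} {μ : K} :
    μ ∈ spectrum K M ↔ ∃ w : n → K, w ≠ 0 ∧ M *ᵥ w = μ • w := by
  rw [← Matrix.spectrum_toLin', ← Module.End.hasEigenvalue_iff_mem_spectrum]
  refine ⟨fun h => ?_, fun ⟨w, hw, h⟩ => ?_⟩
  · obtain ⟨w, hw⟩ := h.exists_hasEigenvector
    exact ⟨w, hw.2, hw.apply_eq_smul⟩
  · exact Module.End.hasEigenvalue_of_hasEigenvector ⟨Module.End.mem_eigenspace_iff.2 h, hw⟩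

theorem isNilpotent_of_forall_mem_spectrum_eq_zero {K : Type*} [Field K] [IsAlgClosed K]
    {M : Matrix n n K} (h : ∀ μ ∈ spectrum K M, μ = 0) : IsNilpotent M := by
  have hroots : M.charpoly.roots = Multiset.replicate M.charpoly.roots.card 0 :=
    Multiset.eq_replicate_card.2 fun μ hμ =>
      h μ (Matrix.mem_spectrum_iff_isRoot_charpoly.2 (Polynomial.isRoot_of_mem_roots hμ))
  have hcharpoly : M.charpoly = Polynomial.X ^ M.charpoly.roots.card := by
    conv_lhs =>
      rw [(IsAlgClosed.splits M.charpoly).eq_prod_roots_of_monic M.charpoly_monic, hroots]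
    simp only [Multiset.map_replicate, Multiset.prod_replicate, map_zero, sub_zero]
  have hcayley := M.aeval_self_charpoly
  rw [hcharpoly, map_pow, Polynomial.aeval_X] at hcayley
  exact ⟨_, hcayley⟩

theorem exists_dominant_eigenvector {W : Matrix n n ℝ} (hW : ¬IsNilpotent W) :
    ∃ (μ : ℂ) (w : n → ℂ), w ≠ 0 ∧ W.map Complex.ofReal *ᵥ w = μ • w ∧ 0 < ‖μ‖ ∧
      ∀ c > ‖μ‖, (fun t => W ^ t) =O[atTop] fun t => c ^ t := by
  have hpow : ∀ t, (W ^ t).map Complex.ofReal = W.map Complex.ofReal ^ t :=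
    map_pow Complex.ofRealHom.mapMatrix W
  have : Nonempty n := not_isEmpty_iff.1 fun _ => hW ⟨0, Subsingleton.elim _ _⟩
  obtain ⟨μ, hμ, hradius⟩ := spectrum.exists_nnnorm_eq_spectralRadius (W.map Complex.ofReal)
  obtain ⟨w, hw, hWw⟩ := mem_spectrum_iff_exists_mulVec.1 hμ
  refine ⟨μ, w, hw, hWw, norm_pos_iff.2 fun hμ0 => hW ?_, fun c hc => ?_⟩
  · have hzero : ∀ z ∈ spectrum ℂ (W.map Complex.ofReal), z = 0 := fun z hz => by
      have hle : (‖z‖₊ : ENNReal) ≤ spectralRadius ℂ (W.map Complex.ofReal) :=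
        le_iSup₂ (f := fun z _ => (‖z‖₊ : ENNReal)) z hz
      simpa [← hradius, hμ0] using hle
    obtain ⟨t, ht⟩ := isNilpotent_of_forall_mem_spectrum_eq_zero hzero
    exact ⟨t, Matrix.map_injective Complex.ofReal_injective (by simp [hpow, ht])⟩
  · have hlt : spectralRadius ℂ (W.map Complex.ofReal) < ENNReal.ofReal c := by
      rw [← hradius, ← enorm_eq_nnnorm, ← ofReal_norm]
      exact (ENNReal.ofReal_lt_ofReal_iff_of_nonneg (norm_nonneg μ)).2 hc
    refine .of_norm_left ((isBigO_pow_of_spectralRadius_lt hlt).norm_left.congr_left fun t => ?_)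
    rw [← hpow, Matrix.frobenius_norm_map_eq _ _ Complex.norm_real]

end SpectralGrowth

section LowestFrequency

variable {V : Type*} {G : Digraph V} [Fintype V] [DecidableEq V]

theorem mem_frequencies_iff {z : ℂ} :
    z ∈ G.frequencies ↔ 1 - z ∈ spectrum ℂ (G.sna.map Complex.ofReal) := by
  have hmap : (1 - G.sna).map (fun r : ℝ => (r : ℂ)) =
      algebraMap ℂ (Matrix V V ℂ) 1 - G.sna.map Complex.ofReal := by
    rw [map_one]
    exact (map_sub Complex.ofRealHom.mapMatrix 1 G.sna).trans (by rw [map_one]; rfl)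
  rw [Digraph.frequencies, hmap, ← spectrum.singleton_sub_eq, Set.singleton_sub]
  exact ⟨by rintro ⟨y, hy, rfl⟩; rwa [sub_sub_cancel], fun h => ⟨1 - z, h, sub_sub_cancel 1 z⟩⟩

theorem isLowestFrequency_one_sub [Nonempty V] {ρ : ℝ} {u : V → ℝ} (hu : ∀ i, 0 < u i)
    (huL : u ᵥ* G.sna = ρ • u) : G.IsLowestFrequency (1 - ρ) := by
  refine ⟨?_, fun z hz => ?_⟩
  · have hu0 : (fun i => (u i : ℂ)) ≠ 0 := fun h =>
      (hu (Classical.arbitrary V)).ne' (Complex.ofReal_eq_zero.1 (congrFun h _))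
    rw [mem_frequencies_iff, Matrix.mem_spectrum_iff_isRoot_charpoly, ← Matrix.charpoly_transpose,
      ← Matrix.mem_spectrum_iff_isRoot_charpoly, mem_spectrum_iff_exists_mulVec]
    refine ⟨_, hu0, funext fun i => ?_⟩
    have h := Complex.ofRealHom.map_vecMul G.sna u i
    rw [huL] at h
    rw [Matrix.mulVec_transpose]
    exact h.symm.trans (by simp)
  · obtain ⟨w, hw, hLw⟩ := mem_spectrum_iff_exists_mulVec.1 (mem_frequencies_iff.1 hz)
    have hle :=
      (Complex.re_le_norm _).trans (norm_le_of_map_mulVec_eq_smul sna_nonneg hu huL hw hLw)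
    rw [Complex.sub_re, Complex.one_re] at hle
    linarith

end LowestFrequency

section FrobeniusInner

variable {m n : Type*} [Fintype m] [Fintype n]

theorem frobenius_norm_sq_eq_sum (x : Matrix m n ℝ) : ‖x‖ ^ 2 = ∑ i, ∑ k, x i k ^ 2 := by
  have hnonneg : 0 ≤ ∑ i, ∑ k, x i k ^ 2 := by positivity
  simp only [Matrix.frobenius_norm_def, ← Real.sqrt_eq_rpow, Real.rpow_two, Real.norm_eq_abs,
    sq_abs, Real.sq_sqrt hnonneg]

/-- The trace inner product `⟪x, y⟫ = tr (xᵀ y)` on real matrices, whose norm is definitionally the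
Frobenius norm. -/
noncomputable scoped instance frobeniusInnerProductSpace : InnerProductSpace ℝ (Matrix m n ℝ) where
  inner x y := ∑ i, ∑ k, x i k * y i k
  norm_sq_eq_re_inner x := by
    simp only [frobenius_norm_sq_eq_sum, RCLike.re_to_real, ← sq]
  conj_inner_symm x y := by simp only [mul_comm, conj_trivial]
  add_left x y z := by
    simp only [Matrix.add_apply, add_mul, Finset.sum_add_distrib]
  smul_left x y r := by
    simp only [Matrix.smul_apply, smul_eq_mul, mul_assoc, Finset.mul_sum, conj_trivial]

theorem inner_eq_sum (x y : Matrix m n ℝ) : inner ℝ x y = ∑ i, ∑ k, x i k * y i k :=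
  rfl

theorem normalizeFeatures_eq_smul (x : Matrix m n ℝ) : normalizeFeatures x = ‖x‖⁻¹ • x := by
  rw [normalizeFeatures, ← frobenius_norm_sq_eq_sum, Real.sqrt_sq (norm_nonneg x)]

theorem norm_normalizeFeatures {x : Matrix m n ℝ} (hx : x ≠ 0) : ‖normalizeFeatures x‖ = 1 := by
  rw [normalizeFeatures_eq_smul, norm_smul, norm_inv, norm_norm,
    inv_mul_cancel₀ (norm_ne_zero_iff.2 hx)]

theorem eq_neg_of_inner_eq_neg_norm_sq {E : Type*} [NormedAddCommGroup E] [InnerProductSpace ℝ E]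
    {x y : E} (hle : ‖y‖ ≤ ‖x‖) (hinner : inner ℝ x y = -‖x‖ ^ 2) : y = -x := by
  have hsq : ‖x + y‖ ^ 2 ≤ 0 := by
    rw [norm_add_sq_real, hinner]
    linarith [pow_le_pow_left₀ (norm_nonneg y) hle 2]
  have hzero : ‖x + y‖ = 0 := pow_eq_zero_iff two_ne_zero |>.1 (hsq.antisymm (sq_nonneg _))
  exact eq_neg_of_add_eq_zero_right (norm_eq_zero.1 hzero)

end FrobeniusInner

section DirichletEnergy

variable {V κ : Type*} {G : Digraph V} [Fintype V] [Fintype κ]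

theorem sum_adjacency_mul_div_sqrt_inDeg_sq (hin : ∀ i, 0 < G.inDeg i) (y : Matrix V κ ℝ) :
    ∑ i, ∑ j, ∑ k, G.adjacency i j * (y i k / √(G.inDeg i)) ^ 2 = ‖y‖ ^ 2 := by
  rw [frobenius_norm_sq_eq_sum]
  refine Finset.sum_congr rfl fun i _ => ?_
  rw [Finset.sum_comm]
  refine Finset.sum_congr rfl fun k _ => ?_
  rw [← Finset.sum_mul, ← Digraph.inDeg, div_pow, Real.sq_sqrt (hin i).le,
    mul_div_cancel₀ _ (hin i).ne']

theorem sum_adjacency_mul_div_sqrt_outDeg_sq (hout : ∀ j, 0 < G.outDeg j) (x : Matrix V κ ℝ) :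
    ∑ i, ∑ j, ∑ k, G.adjacency i j * (x j k / √(G.outDeg j)) ^ 2 = ‖x‖ ^ 2 := by
  rw [frobenius_norm_sq_eq_sum, Finset.sum_comm]
  refine Finset.sum_congr rfl fun j _ => ?_
  rw [Finset.sum_comm]
  refine Finset.sum_congr rfl fun k _ => ?_
  rw [← Finset.sum_mul, ← Digraph.outDeg, div_pow, Real.sq_sqrt (hout j).le,
    mul_div_cancel₀ _ (hout j).ne']

variable [DecidableEq V]

theorem sum_adjacency_mul_div_sqrt_mul_div_sqrt (y x : Matrix V κ ℝ) :
    ∑ i, ∑ j, ∑ k, G.adjacency i j * (y i k / √(G.inDeg i) * (x j k / √(G.outDeg j))) =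
      inner ℝ y (G.sna * x) := by
  rw [inner_eq_sum]
  refine Finset.sum_congr rfl fun i _ => ?_
  rw [Finset.sum_comm]
  refine Finset.sum_congr rfl fun k _ => ?_
  rw [Matrix.mul_apply, Finset.mul_sum]
  refine Finset.sum_congr rfl fun j _ => ?_
  rw [sna_apply]
  ring

theorem sum_adjacency_mul_sub_sq (hin : ∀ i, 0 < G.inDeg i) (hout : ∀ j, 0 < G.outDeg j)
    (y x : Matrix V κ ℝ) :
    ∑ i, ∑ j, G.adjacency i j * ∑ k, (y i k / √(G.inDeg i) - x j k / √(G.outDeg j)) ^ 2 =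
      ‖y‖ ^ 2 - 2 * inner ℝ y (G.sna * x) + ‖x‖ ^ 2 := by
  rw [← sum_adjacency_mul_div_sqrt_inDeg_sq hin y, ← sum_adjacency_mul_div_sqrt_outDeg_sq hout x,
    ← sum_adjacency_mul_div_sqrt_mul_div_sqrt]
  simp only [Finset.mul_sum, ← Finset.sum_sub_distrib, ← Finset.sum_add_distrib]
  refine Finset.sum_congr rfl fun i _ => Finset.sum_congr rfl fun j _ =>
    Finset.sum_congr rfl fun k _ => ?_
  ring

theorem norm_sna_mul_le (hin : ∀ i, 0 < G.inDeg i) (hout : ∀ j, 0 < G.outDeg j)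
    (x : Matrix V κ ℝ) : ‖G.sna * x‖ ≤ ‖x‖ := by
  have hnonneg : 0 ≤ ‖G.sna * x‖ ^ 2 - 2 * inner ℝ (G.sna * x) (G.sna * x) + ‖x‖ ^ 2 := by
    rw [← sum_adjacency_mul_sub_sq hin hout]
    exact Finset.sum_nonneg fun i _ => Finset.sum_nonneg fun j _ =>
      mul_nonneg (adjacency_nonneg i j) (Finset.sum_nonneg fun k _ => sq_nonneg _)
  rw [real_inner_self_eq_norm_sq] at hnonneg
  exact le_of_sq_le_sq (by linarith) (norm_nonneg x)

theorem dirichletEnergy_eq (hin : ∀ i, 0 < G.inDeg i) (hout : ∀ j, 0 < G.outDeg j)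
    (x : Matrix V κ ℝ) : G.dirichletEnergy x = (‖x‖ ^ 2 - inner ℝ x (G.sna * x)) / 2 := by
  rw [Digraph.dirichletEnergy, sum_adjacency_mul_sub_sq hin hout]
  ring

theorem abs_inner_sna_mul_le (hin : ∀ i, 0 < G.inDeg i) (hout : ∀ j, 0 < G.outDeg j)
    (x : Matrix V κ ℝ) : |inner ℝ x (G.sna * x)| ≤ ‖x‖ ^ 2 :=
  calc |inner ℝ x (G.sna * x)| ≤ ‖x‖ * ‖G.sna * x‖ := abs_real_inner_le_norm x _
    _ ≤ ‖x‖ * ‖x‖ := by gcongr; exact norm_sna_mul_le hin hout x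
    _ = ‖x‖ ^ 2 := (sq _).symm

theorem le_one_of_vecMul_sna_eq_smul (hin : ∀ i, 0 < G.inDeg i) (hout : ∀ j, 0 < G.outDeg j)
    {ρ : ℝ} {u : V → ℝ} (hu : u ≠ 0) (huL : u ᵥ* G.sna = ρ • u) : ρ ≤ 1 := by
  let x : Matrix V Unit ℝ := Matrix.replicateCol Unit u
  have hx : 0 < ‖x‖ ^ 2 := by
    refine pow_pos (norm_pos_iff.2 fun h => hu ?_) 2
    exact funext fun i => congrFun (congrFun h i) ()
  have hinner : inner ℝ x (G.sna * x) = ρ * ‖x‖ ^ 2 := by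
    have h : u ⬝ᵥ G.sna *ᵥ u = ρ * (u ⬝ᵥ u) := by
      rw [Matrix.dotProduct_mulVec, huL, smul_dotProduct, smul_eq_mul]
    rw [← real_inner_self_eq_norm_sq, inner_eq_sum, inner_eq_sum]
    simpa [x, Matrix.mul_apply, dotProduct, Matrix.mulVec] using h
  have hle := (le_abs_self _).trans (abs_inner_sna_mul_le hin hout x)
  rw [hinner] at hle
  exact le_of_mul_le_mul_right (by rwa [one_mul]) hx

theorem dirichletEnergy_normalizeFeatures_sub (hin : ∀ i, 0 < G.inDeg i)
    (hout : ∀ j, 0 < G.outDeg j) (ρ : ℝ) {x : Matrix V κ ℝ} (hx : x ≠ 0) :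
    G.dirichletEnergy (normalizeFeatures x) - (1 - ρ) / 2 =
      (ρ - inner ℝ (normalizeFeatures x) (G.sna * normalizeFeatures x)) / 2 := by
  rw [dirichletEnergy_eq hin hout, norm_normalizeFeatures hx]
  ring

theorem abs_dirichletEnergy_normalizeFeatures_sub_le (hin : ∀ i, 0 < G.inDeg i)
    (hout : ∀ j, 0 < G.outDeg j) (ρ : ℝ) {x : Matrix V κ ℝ} (hx : x ≠ 0) :
    |G.dirichletEnergy (normalizeFeatures x) - (1 - ρ) / 2| ≤
      ‖(G.sna - ρ • (1 : Matrix V V ℝ)) * x‖ / ‖x‖ := by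
  set y := normalizeFeatures x with hy
  set D := G.sna - ρ • (1 : Matrix V V ℝ) with hD
  have hinner : inner ℝ y (D * y) = inner ℝ y (G.sna * y) - ρ := by
    rw [hD, Matrix.sub_mul, Matrix.smul_mul, Matrix.one_mul, inner_sub_right,
      real_inner_smul_right, real_inner_self_eq_norm_sq, norm_normalizeFeatures hx, one_pow,
      mul_one]
  have hbound : |inner ℝ y (D * y)| ≤ ‖D * x‖ / ‖x‖ :=
    calc |inner ℝ y (D * y)| ≤ ‖y‖ * ‖D * y‖ := abs_real_inner_le_norm y _
      _ = ‖D * x‖ / ‖x‖ := by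
        rw [norm_normalizeFeatures hx, one_mul, hy, normalizeFeatures_eq_smul, Matrix.mul_smul,
          norm_smul, norm_inv, norm_norm, inv_mul_eq_div]
  rw [dirichletEnergy_normalizeFeatures_sub hin hout ρ hx, ← hy, abs_div, abs_two, abs_sub_comm,
    ← hinner]
  linarith [abs_nonneg (inner ℝ y (D * y))]

/- Equality would force `ρ = 1` and `L y = -y`, which primitivity of `L` excludes. -/
theorem abs_dirichletEnergy_normalizeFeatures_sub_lt_one
    (hin : ∀ i, 0 < G.inDeg i) (hout : ∀ j, 0 < G.outDeg j) (hL : G.sna.IsPrimitive) {ρ : ℝ}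
    (hρ : 0 < ρ) {u : V → ℝ} (hu : ∀ i, 0 < u i) (huL : u ᵥ* G.sna = ρ • u)
    {x : Matrix V κ ℝ} (hx : x ≠ 0) :
    |G.dirichletEnergy (normalizeFeatures x) - (1 - ρ) / 2| < 1 := by
  obtain ⟨i, -⟩ := Function.ne_iff.1 hx
  have hu0 : u ≠ 0 := fun h => (hu i).ne' (congrFun h i)
  have hρ1 : ρ ≤ 1 := le_one_of_vecMul_sna_eq_smul hin hout hu0 huL
  have hnorm := norm_normalizeFeatures hx
  have hR := abs_inner_sna_mul_le hin hout (normalizeFeatures x)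
  rw [dirichletEnergy_normalizeFeatures_sub hin hout ρ hx]
  set y := normalizeFeatures x
  rw [hnorm, one_pow, abs_le] at hR
  rw [abs_lt]
  refine ⟨by linarith, ?_⟩
  by_contra! hge
  have hneg : G.sna * y = -y := by
    refine eq_neg_of_inner_eq_neg_norm_sq (norm_sna_mul_le hin hout y) ?_
    rw [hnorm]
    linarith
  have hy : y = 0 := by
    obtain rfl : ρ = 1 := by linarith
    ext i k
    have hcol : G.sna *ᵥ y.col k = -(1 : ℝ) • y.col k := by
      ext i
      simpa [Matrix.mul_apply, Matrix.mulVec, dotProduct] using congrFun (congrFun hneg i) k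
    exact congrFun (eq_zero_of_mulVec_eq_neg_smul hL hρ hu huL hcol) i
  simp [hy] at hnorm

end DirichletEnergy

section Features

theorem ae_linearMap_ne_zero {E F : Type*} [NormedAddCommGroup E] [NormedSpace ℝ E]
    [FiniteDimensional ℝ E] [MeasurableSpace E] [BorelSpace E] (ν : Measure E)
    [ν.IsAddHaarMeasure] [AddCommGroup F] [Module ℝ F] {φ : E →ₗ[ℝ] F} (hφ : φ ≠ 0) :
    ∀ᵐ x ∂ν, φ x ≠ 0 := by
  have hker : {x | ¬ φ x ≠ 0} = φ.ker := by
    ext x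
    simp
  rw [ae_iff, hker]
  exact Measure.addHaar_submodule ν φ.ker (mt LinearMap.ker_eq_top.1 hφ)

variable {V κ : Type*} [Fintype V] [Fintype κ]

/-- The functional `x ↦ uᵀ x w`, which multiplies by `ρ μ` along the dynamics when `u` and `w` are
a left eigenvector of the propagation matrix and an eigenvector of the weight matrix. -/
def pairing (u : V → ℝ) (w : κ → ℂ) : Matrix V κ ℝ →ₗ[ℝ] ℂ where
  toFun x := (Complex.ofReal ∘ (u ᵥ* x)) ⬝ᵥ w
  map_add' x y := by
    rw [Matrix.vecMul_add, ← add_dotProduct]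
    congr 1
    ext k
    simp
  map_smul' r x := by
    simp [dotProduct, Matrix.vecMul_smul, Finset.mul_sum, mul_assoc]

theorem pairing_apply (u : V → ℝ) (w : κ → ℂ) (x : Matrix V κ ℝ) :
    pairing u w x = (Complex.ofReal ∘ (u ᵥ* x)) ⬝ᵥ w :=
  rfl

theorem pairing_mul_mul {L : Matrix V V ℝ} {W : Matrix κ κ ℝ} {ρ : ℝ} {μ : ℂ} {u : V → ℝ}
    {w : κ → ℂ} (huL : u ᵥ* L = ρ • u) (hWw : W.map Complex.ofReal *ᵥ w = μ • w)
    (x : Matrix V κ ℝ) : pairing u w (L * x * W) = ρ * μ * pairing u w x := by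
  have hmap : Complex.ofReal ∘ ((u ᵥ* x) ᵥ* W) =
      (Complex.ofReal ∘ (u ᵥ* x)) ᵥ* W.map Complex.ofReal :=
    funext fun k => Complex.ofRealHom.map_vecMul W (u ᵥ* x) k
  have hvec : u ᵥ* (L * x * W) = ρ • ((u ᵥ* x) ᵥ* W) := by
    rw [← Matrix.vecMul_vecMul, ← Matrix.vecMul_vecMul, huL, Matrix.smul_vecMul,
      Matrix.smul_vecMul]
  have hscale : pairing u w (L * x * W) = ρ * pairing u w (x * W) := by
    simp [pairing_apply, hvec, dotProduct, Finset.mul_sum, mul_assoc]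
  rw [hscale, pairing_apply, pairing_apply, ← Matrix.vecMul_vecMul, hmap,
    ← Matrix.dotProduct_mulVec, hWw, dotProduct_smul, smul_eq_mul, mul_assoc]

theorem pairing_ne_zero {u : V → ℝ} {w : κ → ℂ} (hu : u ≠ 0) (hw : w ≠ 0) :
    pairing u w ≠ 0 := by
  classical
  obtain ⟨i, hi⟩ := Function.ne_iff.1 hu
  obtain ⟨k, hk⟩ := Function.ne_iff.1 hw
  intro h
  have hik : pairing u w (Matrix.single i k 1) = u i * w k := by
    have hrow : u ᵥ* Matrix.single i k 1 = Pi.single k (u i) := by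
      ext j
      simp [Matrix.vecMul, dotProduct, Matrix.single_apply, Pi.single_apply, ite_and, eq_comm]
    simp [pairing_apply, hrow, dotProduct, Pi.single_apply, apply_ite Complex.ofReal]
  rw [h, LinearMap.zero_apply, eq_comm, mul_eq_zero, Complex.ofReal_eq_zero] at hik
  exact hik.elim hi hk

theorem ae_pairing_ne_zero {u : V → ℝ} {w : κ → ℂ} (hu : u ≠ 0) (hw : w ≠ 0) :
    ∀ᵐ x : V → κ → ℝ, pairing u w (Matrix.of x) ≠ 0 :=
  ae_linearMap_ne_zero volume (φ := pairing u w ∘ₗ (Matrix.ofLinearEquiv ℝ).toLinearMap)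
    fun h => pairing_ne_zero hu hw (LinearMap.ext fun x => LinearMap.congr_fun h (Matrix.of.symm x))

variable [DecidableEq V] {G : Digraph V} {W : Matrix κ κ ℝ} {x₀ : Matrix V κ ℝ}

theorem pairing_gcn {ρ : ℝ} {μ : ℂ} {u : V → ℝ} {w : κ → ℂ} (huL : u ᵥ* G.sna = ρ • u)
    (hWw : W.map Complex.ofReal *ᵥ w = μ • w) (t : ℕ) :
    pairing u w (G.gcn W x₀ t) = (ρ * μ) ^ t * pairing u w x₀ := by
  induction t with
  | zero => rw [Digraph.gcn, pow_zero, one_mul]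
  | succ t ih => rw [Digraph.gcn, pairing_mul_mul huL hWw, ih, pow_succ',
      mul_assoc (ρ * μ : ℂ)]

theorem gcn_ne_zero_of_pairing_ne_zero {ρ : ℝ} {μ : ℂ} {u : V → ℝ} {w : κ → ℂ}
    (huL : u ᵥ* G.sna = ρ • u) (hWw : W.map Complex.ofReal *ᵥ w = μ • w) (hρ : ρ ≠ 0)
    (hμ : μ ≠ 0) (hx₀ : pairing u w x₀ ≠ 0) (t : ℕ) : G.gcn W x₀ t ≠ 0 := by
  intro hzero
  have h := pairing_gcn (x₀ := x₀) huL hWw t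
  rw [hzero, map_zero] at h
  exact mul_ne_zero (pow_ne_zero t (mul_ne_zero (Complex.ofReal_ne_zero.2 hρ) hμ)) hx₀ h.symm

theorem isBigO_gcn_of_pairing_ne_zero {ρ : ℝ} {μ : ℂ} {u : V → ℝ} {w : κ → ℂ}
    (huL : u ᵥ* G.sna = ρ • u) (hWw : W.map Complex.ofReal *ᵥ w = μ • w)
    (hx₀ : pairing u w x₀ ≠ 0) : (fun t => (ρ * μ) ^ t) =O[atTop] G.gcn W x₀ := by
  have hpairing : (fun t => (ρ * μ) ^ t * pairing u w x₀) =O[atTop] G.gcn W x₀ := by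
    simp only [← pairing_gcn huL hWw]
    exact (pairing u w).toContinuousLinearMap.isBigO_comp _ _
  exact (isBigO_self_const_mul hx₀ _ _).congr_right (fun t => mul_comm _ _) |>.trans hpairing

variable [DecidableEq κ]

theorem gcn_eq (t : ℕ) : G.gcn W x₀ t = G.sna ^ t * x₀ * W ^ t := by
  induction t with
  | zero => simp [Digraph.gcn]
  | succ t ih =>
    rw [Digraph.gcn, ih, pow_succ', pow_succ]
    simp only [Matrix.mul_assoc]

theorem isBigO_sub_smul_mul_gcn {ρ q c : ℝ}
    (hL : (fun t => G.sna ^ t * (G.sna - ρ • (1 : Matrix V V ℝ))) =O[atTop] fun t => q ^ t)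
    (hW : (fun t => W ^ t) =O[atTop] fun t => c ^ t) :
    (fun t => (G.sna - ρ • (1 : Matrix V V ℝ)) * G.gcn W x₀ t) =O[atTop]
      fun t => (q * c) ^ t := by
  have hcomm : ∀ t, (G.sna - ρ • (1 : Matrix V V ℝ)) * G.gcn W x₀ t =
      G.sna ^ t * (G.sna - ρ • (1 : Matrix V V ℝ)) * x₀ * W ^ t := fun t => by
    rw [gcn_eq, ← Matrix.mul_assoc, ← Matrix.mul_assoc]
    congr 2
    simp only [sub_mul, mul_sub, smul_mul_assoc, mul_smul_comm, one_mul, mul_one, ← pow_succ,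
      ← pow_succ']
  have hprod : (fun t => G.sna ^ t * (G.sna - ρ • (1 : Matrix V V ℝ)) * x₀ * W ^ t) =O[atTop]
      fun t => ‖G.sna ^ t * (G.sna - ρ • (1 : Matrix V V ℝ))‖ * ‖W ^ t‖ :=
    IsBigO.of_bound ‖x₀‖ <| Eventually.of_forall fun t => by
      refine (Matrix.frobenius_norm_mul _ _).trans ?_
      rw [norm_mul, norm_norm, norm_norm, ← mul_assoc, mul_comm ‖x₀‖]
      gcongr
      exact Matrix.frobenius_norm_mul _ _
  simp only [hcomm, mul_pow]
  exact hprod.trans (hL.norm_left.mul hW.norm_left)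

theorem exists_isBigO_dirichletEnergy_gcn_sub {ρ q : ℝ} {μ : ℂ} {u : V → ℝ} {w : κ → ℂ}
    (hin : ∀ i, 0 < G.inDeg i) (hout : ∀ j, 0 < G.outDeg j) (hq : 0 < q) (hqρ : q < ρ)
    (hL : (fun t => G.sna ^ t * (G.sna - ρ • (1 : Matrix V V ℝ))) =O[atTop] fun t => q ^ t)
    (huL : u ᵥ* G.sna = ρ • u) (hWw : W.map Complex.ofReal *ᵥ w = μ • w) (hμ : 0 < ‖μ‖)
    (hW : ∀ c > ‖μ‖, (fun t => W ^ t) =O[atTop] fun t => c ^ t)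
    (hx₀ : pairing u w x₀ ≠ 0) :
    ∃ p : ℝ, 0 < p ∧ p < 1 ∧
      (fun t => G.dirichletEnergy (normalizeFeatures (G.gcn W x₀ t)) - (1 - ρ) / 2)
        =O[atTop] fun t => p ^ t := by
  have hρ : 0 < ρ := hq.trans hqρ
  obtain ⟨c, hμc, hc⟩ : ∃ c, ‖μ‖ < c ∧ c < ρ * ‖μ‖ / q :=
    exists_between ((lt_div_iff₀ hq).2 (by nlinarith))
  rw [lt_div_iff₀ hq, mul_comm c] at hc
  have hc0 : 0 < c := hμ.trans hμc
  refine ⟨q * c / (ρ * ‖μ‖), by positivity, (div_lt_one (by positivity)).2 hc, ?_⟩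
  have hinv : (fun t => ‖G.gcn W x₀ t‖⁻¹) =O[atTop] fun t => ((ρ * ‖μ‖) ^ t)⁻¹ := by
    refine IsBigO.inv_rev ?_ (Eventually.of_forall fun t h => ?_)
    · refine (isBigO_gcn_of_pairing_ne_zero huL hWw hx₀).norm_norm.congr_left fun t => ?_
      rw [norm_pow, norm_mul, Complex.norm_of_nonneg hρ.le]
    · exact absurd h (by positivity)
  have hquot := (isBigO_sub_smul_mul_gcn (x₀ := x₀) hL (hW c hμc)).norm_left.mul hinv
  simp only [← div_eq_mul_inv, ← div_pow] at hquot
  refine (IsBigO.of_norm_le fun t => ?_).trans hquot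
  exact abs_dirichletEnergy_normalizeFeatures_sub_le hin hout ρ
    (gcn_ne_zero_of_pairing_ne_zero huL hWw hρ.ne' (norm_pos_iff.1 hμ) hx₀ t)

end Features

section ExponentialRate

theorem exists_forall_le_exp_of_isBigO_pow {f : ℕ → ℝ} {p : ℝ} (hp : 0 < p) (hp1 : p < 1)
    (hf : f =O[atTop] fun t => p ^ t) (hlt : ∀ t, |f t| < 1) :
    ∃ C : ℝ, 0 < C ∧ ∀ t : ℕ, |f t| ≤ Real.exp (-C * t) := by
  obtain ⟨s, hps, hs1⟩ := exists_between hp1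
  have hs : 0 < s := hp.trans hps
  have hlarge : ∀ᶠ t in atTop, |f t| ≤ s ^ t := by
    filter_upwards [(hf.trans_isLittleO (isLittleO_pow_pow_of_lt_left hp.le hps)).bound one_pos]
      with t ht
    simpa [abs_of_pos hs] using ht
  obtain ⟨T, hT⟩ := eventually_atTop.1 hlarge
  have hsmall : ∀ᶠ C : ℝ in 𝓝[>] 0, ∀ t ∈ Finset.range T, |f t| ≤ Real.exp (-C * t) := by
    refine (Filter.eventually_all_finset _).2 fun t _ => eventually_nhdsWithin_of_eventually_nhds ?_
    have hlim : Tendsto (fun C : ℝ => Real.exp (-C * t)) (𝓝 0) (𝓝 1) := by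
      have hcont : Continuous fun C : ℝ => Real.exp (-C * t) := by fun_prop
      simpa using hcont.tendsto 0
    exact hlim.eventually (eventually_ge_nhds (hlt t))
  have hrate : ∀ᶠ C : ℝ in 𝓝[>] 0, C ≤ -Real.log s :=
    eventually_nhdsWithin_of_eventually_nhds (eventually_le_nhds (neg_pos.2 (Real.log_neg hs hs1)))
  obtain ⟨C, ⟨hC, hCs⟩, hC0⟩ := ((hsmall.and hrate).and self_mem_nhdsWithin).exists
  refine ⟨C, hC0, fun t => ?_⟩
  rcases lt_or_ge t T with h | h
  · exact hC t (Finset.mem_range.2 h)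
  · refine (hT t h).trans ?_
    rw [← Real.exp_log (pow_pos hs t), Real.log_pow, Real.exp_le_exp, mul_comm]
    gcongr
    linarith

end ExponentialRate

end Oversmoothing

open Oversmoothing in
theorem mainTheorem11 {V κ : Type*} [Fintype V] [DecidableEq V] [Fintype κ] [DecidableEq κ]
    (G : Digraph V) (hconn : G.IsStronglyConnected) (haper : G.IsAperiodic)
    (W : Matrix κ κ ℝ) (hW : ¬ IsNilpotent W) :
    ∃ l : ℝ, 0 ≤ l ∧ G.IsLowestFrequency l ∧
      ∀ᵐ x₀ : V → κ → ℝ,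
        (∀ t : ℕ, G.gcn W (Matrix.of x₀) t ≠ 0) ∧
        G.IsFrequencyDominant (G.gcn W (Matrix.of x₀)) l ∧
        G.DecaysExponentially (G.gcn W (Matrix.of x₀)) l := by
  have : Nonempty V := nonempty_of_isAperiodic haper
  have hin := inDeg_pos hconn haper
  have hout := outDeg_pos hconn haper
  have hprim := isPrimitive_sna hconn haper
  obtain ⟨ρ, u, hρ, hu, huL⟩ := exists_pos_left_eigenvector hprim
  have hu0 : u ≠ 0 := fun h => (hu (Classical.arbitrary V)).ne' (congrFun h _)
  obtain ⟨q, hq, hqρ, hdecay⟩ := exists_isBigO_pow_mul_sub hprim hρ hu huL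
  obtain ⟨μ, w, hw, hWw, hμ, hpow⟩ := exists_dominant_eigenvector hW
  refine ⟨1 - ρ, sub_nonneg.2 (le_one_of_vecMul_sna_eq_smul hin hout hu0 huL),
    isLowestFrequency_one_sub hu huL, ?_⟩
  filter_upwards [ae_pairing_ne_zero hu0 hw] with x₀ hx₀
  have hx := gcn_ne_zero_of_pairing_ne_zero huL hWw hρ.ne' (norm_pos_iff.1 hμ) hx₀
  obtain ⟨p, hp, hp1, hO⟩ :=
    exists_isBigO_dirichletEnergy_gcn_sub hin hout hq hqρ hdecay huL hWw hμ hpow hx₀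
  obtain ⟨C, hC, hexp⟩ := exists_forall_le_exp_of_isBigO_pow hp hp1 hO fun t =>
    abs_dirichletEnergy_normalizeFeatures_sub_lt_one hin hout hprim hρ hu huL (hx t)
  have hlim := hO.trans_tendsto (tendsto_pow_atTop_nhds_zero_of_lt_one hp.le hp1)
  exact ⟨hx, tendsto_sub_nhds_zero_iff.1 hlim, C, hC, fun t _ => hexp t⟩
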